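/- Let $P$ be a group. A crossed $P$-module $(A,\alpha)$ is a group $A$ with a left action $(p,a)\mapsto {}^{p}a$ of $P$ by group automorphisms and a group homomorphism $\alpha:A\to P$ such that $\alpha({}^{p}a)=p\,\alpha(a)\,p^{-1}$ and ${}^{\alpha(a)}b=aba^{-1}$ for all $p\in P$, $a,b\in A$. Crossed $P$-modules form a category $\mathsf{XMod}/P$, in which a morphism $(A,\alpha)\to(B,\beta)$ is a group homomorphism $f:A\to B$ with $\beta f=\alpha$ and $f({}^{p}a)={}^{p}f(a)$ for all $p\in P$, $a\in A$. A crossed $P$-module $(C,\partial)$ is free with basis $\nu:X\to C$, where $X$ is a set, if for every crossed $P$-module $(B,\beta)$ and every function $\nu':X\to B$ with $\beta\nu'=\partial\nu$ there is a unique morphism $\varphi:(C,\partial)\to(B,\beta)$ with $\varphi\nu=\nu'$; it is finitely generated free if it is free with some basis $\nu:X\to C$ with $X$ finite. Let $\Gamma$ be the full subcategory of $\mathsf{XMod}/P$ on the finitely generated free crossed $P$-modules. Theorem (The Embedding Theorem). The functor $$\mathcal U:\mathsf{XMod}/P\longrightarrow(\Gamma^{op},\mathsf{Set}),\qquad \mathcal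 U(A,\alpha)(C,\partial)=\mathrm{Hom}_{\mathsf{XMod}/P}\big((C,\partial),(A,\alpha)\big),$$ into the category of functors $\Gamma^{op}\to\mathsf{Set}$ is a full exact embedding. That is, $\mathcal U$ is full and faithful (so that $\mathcal U(A,\alpha)\cong\mathcal U(B,\beta)$ implies $(A,\alpha)\cong(B,\beta)$), and it is exact: it preserves all finite limits, and it sends regular epimorphisms (coequalisers of some parallel pair of morphisms) to regular epimorphisms. -/

import Mathlib

open CategoryTheory

universe u

/-- A crossed `P`-module `(M, ∂)`: a group `M` on which `P` acts from the left by group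
automorphisms, with a homomorphism `∂ : M → P` such that `∂ (ᵖm) = p (∂ m) p⁻¹` (CM1) and
`^(∂ m) n = m n m⁻¹` (CM2). -/
structure CrossedMod (P : Type u) [Group P] where
  carrier : Type u
  [group : Group carrier]
  [action : MulDistribMulAction P carrier]
  boundary : carrier →* P
  boundary_smul : ∀ (p : P) (m : carrier), boundary (p • m) = p * boundary m * p⁻¹
  peiffer : ∀ m n : carrier, boundary m • n = m * n * m⁻¹

namespace CrossedMod

variable {P : Type u} [Group P]

instance : CoeSort (CrossedMod P) (Type u) := ⟨carrier⟩

instance (A : CrossedMod P) : Group A := A.group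

instance (A : CrossedMod P) : MulDistribMulAction P A := A.action

/-- A morphism of crossed `P`-modules (the component on `P` is the identity): a homomorphism
that is compatible with the boundary maps and with the actions of `P`. -/
@[ext]
structure Hom (A B : CrossedMod P) where
  toMonoidHom : A →* B
  boundary_map : ∀ a : A, B.boundary (toMonoidHom a) = A.boundary a
  map_smul : ∀ (p : P) (a : A), toMonoidHom (p • a) = p • toMonoidHom a

/-- The category `XMod/P` of crossed modules over the fixed group `P`. -/
instance : Category (CrossedMod P) where
  Hom := Hom
  id A := ⟨MonoidHom.id A, fun _ => rfl, fun _ _ => rfl⟩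
  comp f g := ⟨g.toMonoidHom.comp f.toMonoidHom,
    fun a => (g.boundary_map _).trans (f.boundary_map a),
    fun p a => (congrArg g.toMonoidHom (f.map_smul p a)).trans (g.map_smul p _)⟩

/-- `A` is a free crossed `P`-module with basis `ν : X → A`: every function `ν'` from `X` to a
crossed `P`-module `B` with `∂_B ν' = ∂_A ν` extends along `ν` to a unique morphism `A ⟶ B`. -/
def IsFreeOn (A : CrossedMod P) {X : Type u} (ν : X → A) : Prop :=
  ∀ (B : CrossedMod P) (ν' : X → B), (∀ x, B.boundary (ν' x) = A.boundary (ν x)) →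
    ∃! φ : A ⟶ B, ∀ x, φ.toMonoidHom (ν x) = ν' x

variable (P) in
/-- The finitely generated free crossed `P`-modules: those that are free on some finite set. -/
def finGenFree : ObjectProperty (CrossedMod P) := fun A =>
  ∃ (X : Type u) (_ : Finite X) (ν : X → A), A.IsFreeOn ν

variable (P) in
/-- `Γ`, the full subcategory of `XMod/P` on the finitely generated free crossed `P`-modules. -/
abbrev Gam : Type (u + 1) := (finGenFree P).FullSubcategory

variable (P) in
/-- The functor `U : XMod/P ⥤ (Γᵒᵖ, Set)`, `U A C = Hom(C, A)`: the Yoneda embedding followed by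
restriction along the inclusion of `Γ`. -/
def U : CrossedMod P ⥤ (Gam P)ᵒᵖ ⥤ Type u :=
  yoneda ⋙ (Functor.whiskeringLeft _ _ _).obj (finGenFree P).ι.op

end CrossedMod

/-!
The free crossed module on a family `w : X → P` is the Peiffer quotient of the free group on
`P × X`, in which `(p, x)` stands for `ᵖx` and has boundary `p (w x) p⁻¹`. Hence an element `a` of
a crossed module `A` is the same thing as a morphism to `A` from the free crossed module on one
generator of boundary `∂ a`.

Under this identification, naturality with respect to morphisms between finitely generated free
crossed modules says that a transformation `U A ⟶ U B` acts through one function `A → B`. It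
preserves the action and the multiplication because these are probed by the elements `p • x` and
`x * y` of free crossed modules on one and two generators. This gives fullness.

A regular epimorphism does not factor through a proper subobject, so its image is the whole target.
A basis can be lifted along a surjection, so free crossed modules are projective with respect to
surjections and `U` sends these to epimorphisms of presheaves, all of which are regular.
-/

/-- A precrossed `P`-module: the structure of a crossed `P`-module without the Peiffer identity
(CM2). The free crossed modules are built from these. -/
structure PrecrossedMod (P : Type u) [Group P] where
  carrier : Type u
  [group : Group carrier]
  [action : MulDistribMulAction P carrier]
  boundary : carrier →* P
  boundary_smul : ∀ (p : P) (m : carrier), boundary (p • m) = p * boundary m * p⁻¹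

namespace PrecrossedMod

variable {P : Type u} [Group P]

instance : CoeSort (PrecrossedMod P) (Type u) := ⟨carrier⟩

instance (A : PrecrossedMod P) : Group A := A.group

instance (A : PrecrossedMod P) : MulDistribMulAction P A := A.action

section Peiffer

variable (A : PrecrossedMod P)

/-- The Peiffer subgroup of a precrossed module: the smallest normal subgroup modulo which the
Peiffer identity (CM2) holds. -/
def peifferSubgroup : Subgroup A :=
  Subgroup.normalClosure {r | ∃ m n : A, r = (A.boundary m • n) * (m * n * m⁻¹)⁻¹}

instance : A.peifferSubgroup.Normal :=
  Subgroup.normalClosure_normal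

variable {A} in
theorem smul_mem_peifferSubgroup (p : P) {a : A} (ha : a ∈ A.peifferSubgroup) :
    p • a ∈ A.peifferSubgroup := by
  suffices A.peifferSubgroup ≤
      A.peifferSubgroup.comap (MulDistribMulAction.toMonoidHom A p) from this ha
  refine Subgroup.normalClosure_le_normal ?_
  rintro _ ⟨m, n, rfl⟩
  refine Subgroup.subset_normalClosure ⟨p • m, p • n, ?_⟩
  simp [A.boundary_smul, mul_smul, smul_mul']

theorem peifferSubgroup_le_ker_boundary : A.peifferSubgroup ≤ A.boundary.ker := by
  refine Subgroup.normalClosure_le_normal ?_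
  rintro _ ⟨m, n, rfl⟩
  simp [MonoidHom.mem_ker, A.boundary_smul]

instance : MulAction.QuotientAction P A.peifferSubgroup where
  inv_mul_mem p _ _ h := by
    rw [← smul_inv', ← smul_mul']
    exact smul_mem_peifferSubgroup p h

/-- The crossed module associated with a precrossed module: its quotient by the Peiffer
subgroup. -/
def peifferQuotient : CrossedMod P where
  carrier := A ⧸ A.peifferSubgroup
  action := (QuotientGroup.mk'_surjective _).mulDistribMulAction
    (QuotientGroup.mk' A.peifferSubgroup) fun _ _ => rfl
  boundary := QuotientGroup.lift _ A.boundary A.peifferSubgroup_le_ker_boundary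
  boundary_smul p := (QuotientGroup.mk'_surjective _).forall.mpr (A.boundary_smul p)
  peiffer := (QuotientGroup.mk'_surjective _).forall₂.mpr fun m n =>
    mul_inv_eq_one.mp ((QuotientGroup.eq_one_iff _).mpr
      (Subgroup.subset_normalClosure ⟨m, n, rfl⟩))

/-- The projection of a precrossed module onto its Peiffer quotient. -/
def peifferMk : A →* A.peifferQuotient :=
  QuotientGroup.mk' A.peifferSubgroup

theorem peifferMk_surjective : Function.Surjective A.peifferMk :=
  QuotientGroup.mk'_surjective _

theorem peifferMk_smul (p : P) (a : A) : A.peifferMk (p • a) = p • A.peifferMk a :=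
  rfl

theorem boundary_peifferMk (a : A) : A.peifferQuotient.boundary (A.peifferMk a) = A.boundary a :=
  rfl

variable {A} {B : CrossedMod P} (f : A →* B) (hf : ∀ a, B.boundary (f a) = A.boundary a)
  (hsmul : ∀ (p : P) (a : A), f (p • a) = p • f a)

include hf hsmul in
theorem peifferSubgroup_le_ker : A.peifferSubgroup ≤ f.ker := by
  refine Subgroup.normalClosure_le_normal ?_
  rintro _ ⟨m, n, rfl⟩
  simp [MonoidHom.mem_ker, hsmul, ← hf, B.peiffer]

/-- The universal property of the Peiffer quotient: a homomorphism to a crossed module that is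
compatible with the boundary maps and the actions descends to a morphism. -/
def peifferLift : A.peifferQuotient ⟶ B where
  toMonoidHom := QuotientGroup.lift _ f (peifferSubgroup_le_ker f hf hsmul)
  boundary_map := A.peifferMk_surjective.forall.mpr hf
  map_smul p := A.peifferMk_surjective.forall.mpr (hsmul p)

theorem peifferLift_peifferMk (a : A) :
    (peifferLift f hf hsmul).toMonoidHom (A.peifferMk a) = f a :=
  rfl

end Peiffer

section Free

variable {X : Type u}

/-- The free precrossed `P`-module on a family `w : X → P`: the free group on `P × X`, on which
`P` acts by left translation of the generators. The generator `(p, x)` stands for `ᵖx`, so its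
boundary is `p (w x) p⁻¹`. -/
def free (w : X → P) : PrecrossedMod P where
  carrier := FreeGroup (P × X)
  action :=
    { smul := fun p => FreeGroup.map fun y => (p * y.1, y.2)
      one_smul := fun m => by
        change FreeGroup.map _ m = m
        simp
      mul_smul := fun p q m => by
        change FreeGroup.map _ m = FreeGroup.map _ (FreeGroup.map _ m)
        simp [FreeGroup.map.comp, Function.comp_def, mul_assoc]
      smul_mul := fun p => map_mul (FreeGroup.map _)
      smul_one := fun p => map_one (FreeGroup.map _) }
  boundary := FreeGroup.lift fun y => y.1 * w y.2 * y.1⁻¹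
  boundary_smul p m := by
    change ((FreeGroup.lift _).comp (FreeGroup.map _)) m =
      ((MulAut.conj p).toMonoidHom.comp (FreeGroup.lift _)) m
    congr 1
    ext
    simp [mul_assoc]

/-- The element `ᵖx` of the free precrossed module. -/
def freeOf (w : X → P) (p : P) (x : X) : free w :=
  FreeGroup.of (p, x)

variable {w : X → P}

theorem free_monoidHom_ext {G : Type*} [Group G] {f g : free w →* G}
    (h : ∀ p x, f (freeOf w p x) = g (freeOf w p x)) : f = g :=
  FreeGroup.ext_hom f g fun y => h y.1 y.2

theorem smul_freeOf (p q : P) (x : X) : p • freeOf w q x = freeOf w (p * q) x :=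
  FreeGroup.map.of

@[simp]
theorem boundary_freeOf (p : P) (x : X) : (free w).boundary (freeOf w p x) = p * w x * p⁻¹ :=
  FreeGroup.lift_apply_of

variable (w) {A : Type*} [Group A] [MulDistribMulAction P A] (ν : X → A)

/-- The equivariant homomorphism from the free precrossed module that extends a given family. -/
def freeLift : free w →* A :=
  FreeGroup.lift fun y => y.1 • ν y.2

@[simp]
theorem freeLift_freeOf (p : P) (x : X) : freeLift w ν (freeOf w p x) = p • ν x :=
  FreeGroup.lift_apply_of

theorem freeLift_smul (p : P) (m : free w) : freeLift w ν (p • m) = p • freeLift w ν m := by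
  have h : (freeLift w ν).comp (MulDistribMulAction.toMonoidHom (free w) p) =
      (MulDistribMulAction.toMonoidHom A p).comp (freeLift w ν) :=
    free_monoidHom_ext fun q x => by simp [smul_freeOf, mul_smul]
  exact DFunLike.congr_fun h m

end Free

end PrecrossedMod

namespace CrossedMod

universe w w'

variable {P : Type u} [Group P]

@[simp]
theorem comp_toMonoidHom_apply {A B C : CrossedMod P} (f : A ⟶ B) (g : B ⟶ C) (a : A) :
    (f ≫ g).toMonoidHom a = g.toMonoidHom (f.toMonoidHom a) :=
  rfl

theorem hom_ext {A B : CrossedMod P} {f g : A ⟶ B}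
    (h : ∀ a, f.toMonoidHom a = g.toMonoidHom a) : f = g :=
  Hom.ext (MonoidHom.ext h)

section Free

variable {X : Type u}

/-- The free crossed `P`-module on a family `w : X → P`, with a basis element of boundary `w x` for
each `x`. -/
abbrev free (w : X → P) : CrossedMod P :=
  (PrecrossedMod.free w).peifferQuotient

/-- The basis of the free crossed module. -/
def freeBasis (w : X → P) (x : X) : free w :=
  (PrecrossedMod.free w).peifferMk (PrecrossedMod.freeOf w 1 x)

@[simp]
theorem boundary_freeBasis (w : X → P) (x : X) : (free w).boundary (freeBasis w x) = w x := by
  simp [freeBasis, PrecrossedMod.boundary_peifferMk]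

theorem smul_freeBasis (w : X → P) (p : P) (x : X) :
    p • freeBasis w x = (PrecrossedMod.free w).peifferMk (PrecrossedMod.freeOf w p x) := by
  rw [freeBasis, ← PrecrossedMod.peifferMk_smul, PrecrossedMod.smul_freeOf, mul_one]

variable {w : X → P} {B : CrossedMod P}

theorem free_hom_ext {f g : free w ⟶ B}
    (h : ∀ x, f.toMonoidHom (freeBasis w x) = g.toMonoidHom (freeBasis w x)) : f = g := by
  have hmk : f.toMonoidHom.comp (PrecrossedMod.free w).peifferMk =
      g.toMonoidHom.comp (PrecrossedMod.free w).peifferMk :=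
    PrecrossedMod.free_monoidHom_ext fun p x => by
      simp only [MonoidHom.comp_apply, ← smul_freeBasis, f.map_smul, g.map_smul, h]
  exact hom_ext ((PrecrossedMod.free w).peifferMk_surjective.forall.mpr (DFunLike.congr_fun hmk))

theorem boundary_freeLift {ν : X → B} (h : ∀ x, B.boundary (ν x) = w x)
    (m : PrecrossedMod.free w) :
    B.boundary (PrecrossedMod.freeLift w ν m) = (PrecrossedMod.free w).boundary m := by
  have hcomp : B.boundary.comp (PrecrossedMod.freeLift w ν) = (PrecrossedMod.free w).boundary :=
    PrecrossedMod.free_monoidHom_ext fun p x => by simp [B.boundary_smul, h]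
  exact DFunLike.congr_fun hcomp m

/-- The morphism out of a free crossed module determined by its values on the basis. -/
def freeLift (ν : X → B) (h : ∀ x, B.boundary (ν x) = w x) : free w ⟶ B :=
  PrecrossedMod.peifferLift (PrecrossedMod.freeLift w ν) (boundary_freeLift h)
    (PrecrossedMod.freeLift_smul w ν)

@[simp]
theorem freeLift_freeBasis (ν : X → B) (h : ∀ x, B.boundary (ν x) = w x) (x : X) :
    (freeLift ν h).toMonoidHom (freeBasis w x) = ν x := by
  simp [freeLift, freeBasis, PrecrossedMod.peifferLift_peifferMk]

variable (w) in
theorem isFreeOn_freeBasis : (free w).IsFreeOn (freeBasis w) := fun _ ν hν =>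
  have hw x := (hν x).trans (boundary_freeBasis w x)
  ⟨freeLift ν hw, freeLift_freeBasis ν hw,
    fun _ hφ => free_hom_ext fun x => (hφ x).trans (freeLift_freeBasis ν hw x).symm⟩

variable (w) in
theorem finGenFree_free [Finite X] : finGenFree P (free w) :=
  ⟨X, inferInstance, freeBasis w, isFreeOn_freeBasis w⟩

end Free

section Element

/-- The free crossed module on one generator of boundary `p`; morphisms from it to `A` are the
elements of `A` of boundary `p`. -/
abbrev freeOne (p : P) : CrossedMod P :=
  free fun _ : PUnit.{u + 1} => p

/-- The generator of `freeOne p`. -/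
abbrev freeOneGen (p : P) : freeOne p :=
  freeBasis (fun _ : PUnit.{u + 1} => p) PUnit.unit

variable {A B : CrossedMod P} {p : P}

/-- An element `a` of boundary `p`, as a morphism. The boundary is a free parameter `p` rather than
`A.boundary a` so that `ofElement a` and its composite with a morphism have the same source
definitionally. -/
def ofElement (a : A) (h : A.boundary a = p) : freeOne p ⟶ A :=
  freeLift (fun _ => a) fun _ => h

@[simp]
theorem ofElement_freeOneGen (a : A) (h : A.boundary a = p) :
    (ofElement a h).toMonoidHom (freeOneGen p) = a :=
  freeLift_freeBasis _ _ _

theorem ofElement_comp (a : A) (h : A.boundary a = p) (f : A ⟶ B) :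
    ofElement a h ≫ f = ofElement (f.toMonoidHom a) ((f.boundary_map a).trans h) :=
  free_hom_ext fun _ => by simp [ofElement]

end Element

section Full

variable {A B : CrossedMod P} (η : (U P).obj A ⟶ (U P).obj B)

/-- The component of a natural transformation at an object of `Γ`, as a map of hom-sets. -/
def component {C : CrossedMod P} (hC : finGenFree P C) (g : C ⟶ A) : C ⟶ B :=
  η.app (Opposite.op ⟨C, hC⟩) g

theorem component_comp {C D : CrossedMod P} (hC : finGenFree P C) (hD : finGenFree P D)
    (k : D ⟶ C) (g : C ⟶ A) : component η hD (k ≫ g) = k ≫ component η hC g :=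
  NatTrans.naturality_apply η
    (ObjectProperty.homMk k : (⟨D, hD⟩ : Gam P) ⟶ ⟨C, hC⟩).op g

/-- The function on elements induced by a natural transformation, elements being viewed as
morphisms out of free crossed modules on one generator. -/
def inducedFun (a : A) : B :=
  (component η (finGenFree_free _) (ofElement a rfl)).toMonoidHom (freeOneGen (A.boundary a))

theorem component_ofElement {p : P} (a : A) (h : A.boundary a = p) :
    (component η (finGenFree_free _) (ofElement a h)).toMonoidHom (freeOneGen p) =
      inducedFun η a := by
  subst h
  rfl

theorem component_apply {C : CrossedMod P} (hC : finGenFree P C) (g : C ⟶ A) (c : C) :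
    (component η hC g).toMonoidHom c = inducedFun η (g.toMonoidHom c) := by
  rw [← component_ofElement η (g.toMonoidHom c) (g.boundary_map c), ← ofElement_comp c rfl g,
    component_comp η hC, comp_toMonoidHom_apply, ofElement_freeOneGen]

theorem boundary_inducedFun (a : A) : B.boundary (inducedFun η a) = A.boundary a :=
  (Hom.boundary_map _ _).trans (boundary_freeBasis _ _)

theorem inducedFun_smul (p : P) (a : A) : inducedFun η (p • a) = p • inducedFun η a := by
  have h := component_apply η (finGenFree_free _) (ofElement a rfl) (p • freeOneGen _)
  rw [Hom.map_smul, Hom.map_smul, component_apply, ofElement_freeOneGen] at h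
  exact h.symm

theorem inducedFun_mul (a b : A) :
    inducedFun η (a * b) = inducedFun η a * inducedFun η b := by
  let ν : ULift.{u} Bool → A := fun i => cond i.down a b
  have h := component_apply η (finGenFree_free fun i => A.boundary (ν i))
    (freeLift ν fun _ => rfl) (freeBasis _ ⟨true⟩ * freeBasis _ ⟨false⟩)
  rw [map_mul, map_mul, component_apply, component_apply, freeLift_freeBasis,
    freeLift_freeBasis] at h
  exact h.symm

/-- The morphism of crossed modules induced by a natural transformation. -/
def inducedHom : A ⟶ B where
  toMonoidHom := MonoidHom.mk' (inducedFun η) (inducedFun_mul η)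
  boundary_map := boundary_inducedFun η
  map_smul := inducedFun_smul η

theorem U_map_inducedHom : (U P).map (inducedHom η) = η := by
  ext C g
  exact hom_ext fun c => (component_apply η C.unop.property g c).symm

instance full_U : (U P).Full where
  map_surjective η := ⟨inducedHom η, U_map_inducedHom η⟩

end Full

instance faithful_U : (U P).Faithful where
  map_injective {A B f g} h := by
    refine hom_ext fun a => ?_
    have hcomp : ofElement a rfl ≫ f = ofElement a rfl ≫ g :=
      ConcreteCategory.congr_hom (NatTrans.congr_app h
        (Opposite.op ⟨freeOne (A.boundary a), finGenFree_free _⟩)) (ofElement a rfl)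
    simpa using congrArg (fun k => Hom.toMonoidHom k (freeOneGen _)) hcomp

instance preservesLimitsOfSize_U : Limits.PreservesLimitsOfSize.{w', w} (U P) :=
  Limits.preservesLimits_of_evaluation _ fun C =>
    inferInstanceAs (Limits.PreservesLimitsOfSize.{w', w} (coyoneda.obj (.op C.unop.obj)))

section Image

variable {A B : CrossedMod P}

theorem mono_of_injective (f : A ⟶ B) (hf : Function.Injective f.toMonoidHom) : Mono f where
  right_cancellation _ _ e :=
    hom_ext fun c => hf (DFunLike.congr_fun (congrArg Hom.toMonoidHom e) c)

theorem surjective_of_isSplitEpi (f : A ⟶ B) [IsSplitEpi f] :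
    Function.Surjective f.toMonoidHom := fun b =>
  ⟨(section_ f).toMonoidHom b,
    DFunLike.congr_fun (congrArg Hom.toMonoidHom (IsSplitEpi.id f)) b⟩

/-- The crossed submodule on a subgroup stable under the action of `P`. -/
def ofSubgroup (S : Subgroup B) (hS : ∀ (p : P), ∀ b ∈ S, p • b ∈ S) : CrossedMod P where
  carrier := S
  action :=
    letI : SMul P S := ⟨fun p b => ⟨p • (b : B), hS p b b.2⟩⟩
    Subtype.coe_injective.mulDistribMulAction S.subtype fun _ _ => rfl
  boundary := B.boundary.comp S.subtype
  boundary_smul p b := B.boundary_smul p b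
  peiffer b c := Subtype.ext (B.peiffer b c)

/-- The inclusion of a crossed submodule. -/
def ofSubgroupι (S : Subgroup B) (hS : ∀ (p : P), ∀ b ∈ S, p • b ∈ S) : ofSubgroup S hS ⟶ B where
  toMonoidHom := S.subtype
  boundary_map _ := rfl
  map_smul _ _ := rfl

theorem smul_mem_range (f : A ⟶ B) (p : P) :
    ∀ b ∈ f.toMonoidHom.range, p • b ∈ f.toMonoidHom.range := by
  rintro _ ⟨a, rfl⟩
  exact ⟨p • a, f.map_smul p a⟩

/-- The corestriction of a morphism to its image. -/
def toImage (f : A ⟶ B) : A ⟶ ofSubgroup f.toMonoidHom.range (smul_mem_range f) where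
  toMonoidHom := f.toMonoidHom.rangeRestrict
  boundary_map a := f.boundary_map a
  map_smul p a := Subtype.ext (f.map_smul p a)

theorem surjective_of_extremalEpi (f : A ⟶ B) [ExtremalEpi f] :
    Function.Surjective f.toMonoidHom := by
  let ι := ofSubgroupι f.toMonoidHom.range (smul_mem_range f)
  have : Mono ι := mono_of_injective ι Subtype.coe_injective
  have : IsIso ι := ExtremalEpi.isIso f (toImage f) ι rfl
  intro b
  obtain ⟨⟨_, a, rfl⟩, ha⟩ := surjective_of_isSplitEpi ι b
  exact ⟨a, ha⟩

end Image

theorem IsFreeOn.exists_comp_eq {A B C : CrossedMod P} {X : Type u} {ν : X → C}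
    (hC : C.IsFreeOn ν) {f : A ⟶ B} (hf : Function.Surjective f.toMonoidHom) (g : C ⟶ B) :
    ∃ k : C ⟶ A, k ≫ f = g := by
  choose s hs using hf
  obtain ⟨k, hk, -⟩ := hC A (fun x => s (g.toMonoidHom (ν x))) fun x => by
    rw [← f.boundary_map, hs, g.boundary_map]
  refine ⟨k, (hC B _ fun x => g.boundary_map (ν x)).unique (fun x => ?_) fun _ => rfl⟩
  rw [comp_toMonoidHom_apply, hk, hs]

theorem epi_U_map {A B : CrossedMod P} {f : A ⟶ B} (hf : Function.Surjective f.toMonoidHom) :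
    Epi ((U P).map f) := by
  refine (NatTrans.epi_iff_epi_app _).mpr fun C => (epi_iff_surjective _).mpr fun g => ?_
  obtain ⟨X, -, ν, hν⟩ := C.unop.property
  exact hν.exists_comp_eq hf g

theorem isRegularEpi_U_map {A B : CrossedMod P} (f : A ⟶ B) [ExtremalEpi f] :
    IsRegularEpi ((U P).map f) :=
  have := epi_U_map (surjective_of_extremalEpi f)
  IsRegularEpiCategory.regularEpiOfEpi _

end CrossedMod

/-- `U` is a full exact embedding: full, faithful (hence injective on isomorphism classes of
objects, which is stated too), and it preserves finite limits and regular epimorphisms. -/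
theorem mainTheorem2 (P : Type u) [Group P] :
    (CrossedMod.U P).Full ∧ (CrossedMod.U P).Faithful ∧
    (∀ A B : CrossedMod P,
      Nonempty ((CrossedMod.U P).obj A ≅ (CrossedMod.U P).obj B) → Nonempty (A ≅ B)) ∧
    Limits.PreservesFiniteLimits (CrossedMod.U P) ∧
    (∀ {A B : CrossedMod P} (f : A ⟶ B), IsRegularEpi f →
      IsRegularEpi ((CrossedMod.U P).map f)) := by
  refine ⟨CrossedMod.full_U, CrossedMod.faithful_U,
    fun _ _ ⟨e⟩ => ⟨(CrossedMod.U P).preimageIso e⟩, inferInstance, ?_⟩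
  intro A B f hf
  exact CrossedMod.isRegularEpi_U_map f
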